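/- Let $n,m\ge 1$, $\alpha,\beta>0$, $\lambda_1,\lambda_2>1$, and use the $\ell^\infty$ metric on $\mathbb R^n$ and $\mathbb R^m$. Let $s^n_t(x,y)$ ($x,y\in\mathbb R^n$, $t>0$) and $s^m_t(x,y)$ ($x,y\in\mathbb R^m$, $t>0$) be complex-valued kernels, jointly measurable in $(t,x,y)$, and put $\theta^n_tf(y)=\int_{\mathbb R^n}s^n_t(y,z)f(z)\,dz$, and likewise $\theta^m_t$. Assume that: (i) (size condition) for all $t>0$ and all $x,y$, $$|s^n_t(x,y)|\le A_1\frac{t^\alpha}{(t+|x-y|)^{n+\alpha}},\qquad |s^m_t(x,y)|\le A_2\frac{t^\beta}{(t+|x-y|)^{m+\beta}};$$ (ii) (one-parameter $L^2$ bounds) for all $f\in L^2(\mathbb R^n)$, $$\Big(\int_{\mathbb R^n}\iint_{\mathbb R^{n+1}_+}|\theta^n_tf(y)|^2\Big(\frac{t}{t+|x-y|}\Big)^{n\lambda_1}\frac{dy\,dt}{t^{n+1}}\,dx\Big)^{1/2}\le B_1\|f\|_{L^2(\mathbb R^n)},$$ and the same holds for $\theta^m_t$ on $\mathbb R^m$,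 with $\lambda_2$ and a constant $B_2$ in place of $\lambda_1$ and $B_1$. Let $\theta_{t_1,t_2}=\theta^n_{t_1}\otimes\theta^m_{t_2}$ be the operator with kernel $K_{t_1,t_2}(x,y)=s^n_{t_1}(x_1,y_1)\,s^m_{t_2}(x_2,y_2)$ on $\mathbb R^{n+m}=\mathbb R^n\times\mathbb R^m$. A dyadic grid in $\mathbb R^d$ is a family of half-open cubes with side lengths in $\{2^k:k\in\mathbb Z\}$ such that for every $k\in\mathbb Z$ the cubes of side length $2^k$ partition $\mathbb R^d$, and any two cubes of the family are nested or disjoint. For a cube $I$ with side length $\ell(I)$ let $W_I=I\times(\ell(I)/2,\ell(I))$. For a product $\mathcal D=\mathcal D_n\times\mathcal D_m$ of dyadic grids in $\mathbb R^n$ and $\mathbb R^m$, and $I\times J\in\mathcal D$, let $$C^{\mathcal D}_{IJ}=\iint_{W_J}\iint_{W_I}\iint_{\mathbb R^{n+m}}|\theta_{t_1,t_2}\mathbf 1(y_1,y_2)|^2\Big(\frac{t_1}{t_1+|x_1-y_1|}\Big)^{n\lambda_1}\Big(\frac{t_2}{t_2+|x_2-y_2|}\Big)^{m\lambda_2}\frac{dy_1\,dy_2}{t_1^n\,t_2^m}\,\frac{dx_1\,dt_1}{t_1}\,\frac{dx_2\,dt_2}{t_2}.$$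 Then the bi-parameter Carleson condition holds: there is a constant $C$, depending only on $n,m,\alpha,\beta,\lambda_1,\lambda_2,A_1,A_2,B_1,B_2$, such that for every such $\mathcal D$ $$\sum_{\substack{I\times J\in\mathcal D\\ I\times J\subset\Omega}}C^{\mathcal D}_{IJ}\le C\,|\Omega|$$ for every set $\Omega\subset\mathbb R^{n+m}$ such that $|\Omega|<\infty$ and such that for every $x\in\Omega$ there is $I\times J\in\mathcal D$ with $x\in I\times J\subset\Omega$. -/

import Mathlib

open MeasureTheory Set
open scoped ENNReal NNReal

noncomputable section

namespace BiparameterCarleson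

/-- `ℝᵈ` with Lebesgue measure and the `ℓ^∞` metric. -/
abbrev E (d : ℕ) : Type := Fin d → ℝ

/-- The half-open cube with lower corner `corner` and side length `2 ^ scale`. -/
structure DyadicCube (d : ℕ) where
  corner : E d
  scale : ℤ

namespace DyadicCube

variable {d : ℕ}

def side (Q : DyadicCube d) : ℝ := (2 : ℝ) ^ Q.scale

def toSet (Q : DyadicCube d) : Set (E d) :=
  Set.pi Set.univ fun i => Set.Ico (Q.corner i) (Q.corner i + Q.side)

/-- The Whitney region `Q × (ℓ(Q)/2, ℓ(Q))`; its points are the pairs `(x, t)`. -/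
def whitney (Q : DyadicCube d) : Set (E d × ℝ) :=
  Q.toSet ×ˢ Set.Ioo (Q.side / 2) Q.side

end DyadicCube

/-- Dyadic grids: for every integer `k` the cubes of side length `2 ^ k` partition the space, and
any two cubes of the grid are nested or disjoint. -/
structure IsDyadicGrid {d : ℕ} (D : Set (DyadicCube d)) : Prop where
  partition : ∀ (k : ℤ) (x : E d), ∃! Q : DyadicCube d, Q ∈ D ∧ Q.scale = k ∧ x ∈ Q.toSet
  nested : ∀ Q ∈ D, ∀ R ∈ D, Q.scale ≤ R.scale → Q.toSet ⊆ R.toSet ∨ Disjoint Q.toSet R.toSet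

/-- The factor `(t / (t + |x - y|)) ^ (d λ) / t ^ (d + 1)`, that is, the Littlewood-Paley weight
together with the density of `dy dt / t ^ (d + 1)`. -/
def gWeight (d : ℕ) (lam t : ℝ) (x y : E d) : ℝ :=
  (t / (t + ‖x - y‖)) ^ ((d : ℝ) * lam) / t ^ (d + 1)

/-! One parameter. A kernel `s` is read as `s t x y`; only `0 < t` is relevant. -/

/-- Joint Lebesgue measurability of a kernel in `(t, x, y)`, `0 < t`. -/
def KernelMeasurable {d : ℕ} (s : ℝ → E d → E d → ℂ) : Prop :=
  AEStronglyMeasurable (fun p : ℝ × E d × E d => s p.1 p.2.1 p.2.2)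
    ((volume.restrict (Set.Ioi (0 : ℝ))).prod (volume.prod volume))

def SizeCondition {d : ℕ} (α : ℝ) (A : ℝ≥0) (s : ℝ → E d → E d → ℂ) : Prop :=
  ∀ t : ℝ, 0 < t → ∀ x y : E d,
    ‖s t x y‖ ≤ A * (t ^ α / (t + ‖x - y‖) ^ ((d : ℝ) + α))

/-- `θ_t f (y) = ∫ s_t(y, z) f(z) dz`. -/
def theta {d : ℕ} (s : ℝ → E d → E d → ℂ) (t : ℝ) (f : E d → ℂ) (y : E d) : ℂ :=
  ∫ z, s t y z * f z

/-- The one-parameter Littlewood-Paley function `g_λ^*`; in `p = (y, t)` the integral is over the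
upper half-space. -/
def gStar {d : ℕ} (lam : ℝ) (s : ℝ → E d → E d → ℂ) (f : E d → ℂ) (x : E d) : ℝ≥0∞ :=
  (∫⁻ p : E d × ℝ in Set.univ ×ˢ Set.Ioi (0 : ℝ),
    ‖theta s p.2 f p.1‖ₑ ^ 2 * ENNReal.ofReal (gWeight d lam p.2 x p.1)) ^ (1 / 2 : ℝ)

/-- `‖g_λ^* f‖_{L²} ≤ B ‖f‖_{L²}` for all `f ∈ L²`. -/
def GStarL2Bound {d : ℕ} (lam : ℝ) (B : ℝ≥0) (s : ℝ → E d → E d → ℂ) : Prop :=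
  ∀ f : E d → ℂ, MemLp f 2 volume →
    eLpNorm (gStar lam s f) 2 volume ≤ (B : ℝ≥0∞) * eLpNorm f 2 volume

/-! Two parameters. A kernel `K` is read as `K t₁ t₂ x y`, with `x, y ∈ ℝⁿ × ℝᵐ`. -/

/-- The kernel of `θ_{t₁}^n ⊗ θ_{t₂}^m`. -/
def tensorKernel {n m : ℕ} (sn : ℝ → E n → E n → ℂ) (sm : ℝ → E m → E m → ℂ) :
    ℝ → ℝ → E n × E m → E n × E m → ℂ :=
  fun t₁ t₂ x y => sn t₁ x.1 y.1 * sm t₂ x.2 y.2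

/-- `θ_{t₁,t₂} f (y) = ∫ K_{t₁,t₂}(y, z) f(z) dz`. -/
def biTheta {n m : ℕ} (K : ℝ → ℝ → E n × E m → E n × E m → ℂ) (t₁ t₂ : ℝ)
    (f : E n × E m → ℂ) (y : E n × E m) : ℂ :=
  ∫ z, K t₁ t₂ y z * f z

/-- The Carleson coefficient `C_{IJ}`; here `p = (x₁, t₁)` and `q = (x₂, t₂)`. -/
def carlesonCoeff {n m : ℕ} (lam₁ lam₂ : ℝ) (K : ℝ → ℝ → E n × E m → E n × E m → ℂ)
    (I : DyadicCube n) (J : DyadicCube m) : ℝ≥0∞ :=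
  ∫⁻ q : E m × ℝ in J.whitney, ∫⁻ p : E n × ℝ in I.whitney, ∫⁻ y : E n × E m,
    ‖biTheta K p.2 q.2 (fun _ => 1) y‖ₑ ^ 2 *
      ENNReal.ofReal (gWeight n lam₁ p.2 p.1 y.1 * gWeight m lam₂ q.2 q.1 y.2)

/-- The sets for which the Carleson condition is tested: finite measure, and every point lies in a
rectangle of the product grid that is contained in the set. -/
def Admissible {n m : ℕ} (Dn : Set (DyadicCube n)) (Dm : Set (DyadicCube m))
    (Ω : Set (E n × E m)) : Prop :=
  volume Ω < ∞ ∧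
    ∀ x ∈ Ω, ∃ I ∈ Dn, ∃ J ∈ Dm, x ∈ I.toSet ×ˢ J.toSet ∧ I.toSet ×ˢ J.toSet ⊆ Ω

/-- The bi-parameter Carleson condition with constant `C`. -/
def CarlesonCondition {n m : ℕ} (lam₁ lam₂ : ℝ) (C : ℝ≥0)
    (K : ℝ → ℝ → E n × E m → E n × E m → ℂ) : Prop :=
  ∀ (Dn : Set (DyadicCube n)) (Dm : Set (DyadicCube m)), IsDyadicGrid Dn → IsDyadicGrid Dm →
    ∀ Ω : Set (E n × E m), Admissible Dn Dm Ω →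
      ∑' R : {R : DyadicCube n × DyadicCube m //
          R.1 ∈ Dn ∧ R.2 ∈ Dm ∧ R.1.toSet ×ˢ R.2.toSet ⊆ Ω},
        carlesonCoeff lam₁ lam₂ K R.1.1 R.1.2 ≤ (C : ℝ≥0∞) * volume Ω

end BiparameterCarleson

end

noncomputable section

namespace BiparameterCarleson

/-! ### Dyadic grids -/

namespace DyadicCube

variable {d : ℕ}

/-! The function `θ_{t₁,t₂} 1` is a product of one-parameter functions of `y₁` and `y₂`, and so is
the weight. Hence `C_{IJ}` is at most `a_I * b_J`, the product of two one-parameter coefficients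
(`whitneyMass`).

Each factor is a Carleson sequence (`tsum_whitneyMass_le`). Over a cube `R`, split `1` into the
indicators of a dilate of `R` and of its complement. The `L²` bound controls the local part. On the
complement the size condition or the decay of the weight gains a positive power of `t / ℓ(R)`, which
is integrable against `dt / t` on `(0, ℓ(R))`. Passing to maximal cubes replaces `R` by an arbitrary
set.

Carleson bounds on rectangles do not in general give bounds on arbitrary sets `Ω`, but for product
sequences they do (`tsum_mul_le_of_carleson`): sum over `J` for fixed `I`, then over `I` in the
slices of `Ω`, and apply Tonelli. -/

lemma side_pos (Q : DyadicCube d) : 0 < Q.side := zpow_pos two_pos _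

lemma corner_mem_toSet (Q : DyadicCube d) : Q.corner ∈ Q.toSet := fun _ _ =>
  ⟨le_rfl, lt_add_of_pos_right _ Q.side_pos⟩

lemma measurableSet_toSet (Q : DyadicCube d) : MeasurableSet Q.toSet :=
  MeasurableSet.univ_pi fun _ => measurableSet_Ico

lemma measurableSet_whitney (Q : DyadicCube d) : MeasurableSet Q.whitney :=
  Q.measurableSet_toSet.prod measurableSet_Ioo

lemma volume_toSet (Q : DyadicCube d) : volume Q.toSet = ENNReal.ofReal (Q.side ^ d) := by
  simp [toSet, Real.volume_pi_Ico, ENNReal.ofReal_pow Q.side_pos.le]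

lemma norm_sub_corner_le (Q : DyadicCube d) {x : E d} (hx : x ∈ Q.toSet) :
    ‖x - Q.corner‖ ≤ Q.side := by
  refine (pi_norm_le_iff_of_nonneg Q.side_pos.le).2 fun i => ?_
  have h := hx i (mem_univ i)
  rw [Pi.sub_apply, Real.norm_eq_abs, abs_le]
  constructor <;> linarith [h.1, h.2, Q.side_pos]

lemma side_le_side {Q R : DyadicCube d} (h : Q.scale ≤ R.scale) : Q.side ≤ R.side :=
  zpow_le_zpow_right₀ one_le_two h

lemma side_le_half_side {Q R : DyadicCube d} (h : Q.scale < R.scale) :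
    Q.side ≤ R.side / 2 := by
  have h1 : Q.side ≤ (2 : ℝ) ^ (R.scale - 1) := zpow_le_zpow_right₀ one_le_two (by omega)
  rwa [zpow_sub_one₀ two_ne_zero, ← div_eq_mul_inv] at h1

lemma scale_le_of_toSet_subset (hd : 1 ≤ d) {Q R : DyadicCube d} (h : Q.toSet ⊆ R.toSet) :
    Q.scale ≤ R.scale := by
  have h1 := measure_mono (μ := volume) h
  rw [volume_toSet, volume_toSet, ENNReal.ofReal_le_ofReal_iff (pow_nonneg R.side_pos.le _),
    pow_le_pow_iff_left₀ Q.side_pos.le R.side_pos.le (by omega)] at h1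
  exact (zpow_le_zpow_iff_right₀ one_lt_two).1 h1

end DyadicCube

namespace IsDyadicGrid

variable {d : ℕ} {D : Set (DyadicCube d)}

lemma eq_of_mem_of_mem (hD : IsDyadicGrid D) {Q R : DyadicCube d} (hQ : Q ∈ D) (hR : R ∈ D)
    (h : Q.scale = R.scale) {x : E d} (hxQ : x ∈ Q.toSet) (hxR : x ∈ R.toSet) : Q = R :=
  (hD.partition R.scale x).unique ⟨hQ, h, hxQ⟩ ⟨hR, rfl, hxR⟩

/-- At each scale the cubes are disjoint with nonempty interior in a separable space. -/
lemma countable (hD : IsDyadicGrid D) : D.Countable := by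
  have h : ∀ k : ℤ, {Q ∈ D | Q.scale = k}.Countable := by
    intro k
    refine Set.PairwiseDisjoint.countable_of_nonempty_interior (s := DyadicCube.toSet) ?_ ?_
    · intro Q hQ R hR hne
      refine Set.disjoint_left.2 fun x hx hx' => hne ?_
      exact hD.eq_of_mem_of_mem hQ.1 hR.1 (hQ.2.trans hR.2.symm) hx hx'
    · intro Q _
      rw [DyadicCube.toSet, interior_pi_set finite_univ]
      refine univ_pi_nonempty_iff.2 fun i => ?_
      rw [interior_Ico]
      exact nonempty_Ioo.2 (lt_add_of_pos_right _ Q.side_pos)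
  refine (countable_iUnion h).mono fun Q hQ => ?_
  simpa using hQ

lemma disjoint_whitney (hD : IsDyadicGrid D) {Q R : DyadicCube d} (hQ : Q ∈ D) (hR : R ∈ D)
    (hne : Q ≠ R) : Disjoint Q.whitney R.whitney := by
  refine Set.disjoint_left.2 ?_
  rintro ⟨x, t⟩ ⟨hxQ, htQ⟩ ⟨hxR, htR⟩
  rcases lt_trichotomy Q.scale R.scale with h | h | h
  · exact (htQ.2.trans_le (DyadicCube.side_le_half_side h)).not_gt htR.1
  · exact hne (hD.eq_of_mem_of_mem hQ hR h hxQ hxR)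
  · exact (htR.2.trans_le (DyadicCube.side_le_half_side h)).not_gt htQ.1

/-- The maximal cubes of the grid contained in a set. -/
def maximalCubes (D : Set (DyadicCube d)) (U : Set (E d)) : Set (DyadicCube d) :=
  {R | R ∈ D ∧ R.toSet ⊆ U ∧ ∀ R' ∈ D, R'.toSet ⊆ U → R.toSet ⊆ R'.toSet → R'.scale ≤ R.scale}

lemma exists_maximal (hd : 1 ≤ d) {U : Set (E d)} (hU : volume U ≠ ∞) {Q : DyadicCube d}
    (hQ : Q ∈ D) (hQU : Q.toSet ⊆ U) : ∃ R ∈ maximalCubes D U, Q.toSet ⊆ R.toSet := by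
  obtain ⟨b, hb⟩ := pow_unbounded_of_one_lt (volume U).toReal (one_lt_two (α := ℝ))
  have hbdd : ∀ R : DyadicCube d, R.toSet ⊆ U → R.scale ≤ b := by
    intro R hR
    by_contra! hlt
    have h1 : R.side ^ d ≤ (volume U).toReal := by
      rw [← ENNReal.ofReal_le_iff_le_toReal hU, ← R.volume_toSet]
      exact measure_mono hR
    have h2 : (2 : ℝ) ^ b ≤ R.side := by
      rw [← zpow_natCast]
      exact zpow_le_zpow_right₀ one_le_two hlt.le
    -- Since `b` is a natural number, the side is at least `1`.
    have h3 : R.side ≤ R.side ^ d :=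
      le_self_pow₀ ((one_le_pow₀ one_le_two).trans h2) (by omega)
    linarith
  obtain ⟨k, ⟨R, hR, hRU, hQR, rfl⟩, hk⟩ := Int.exists_greatest_of_bdd
    (P := fun k => ∃ R ∈ D, R.toSet ⊆ U ∧ Q.toSet ⊆ R.toSet ∧ R.scale = k)
    ⟨b, by rintro _ ⟨R, -, hRU, -, rfl⟩; exact hbdd R hRU⟩
    ⟨Q.scale, Q, hQ, hQU, subset_rfl, rfl⟩
  exact ⟨R, ⟨hR, hRU, fun R' hR' hR'U h => hk _ ⟨R', hR', hR'U, hQR.trans h, rfl⟩⟩, hQR⟩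

lemma pairwiseDisjoint_maximalCubes (hD : IsDyadicGrid D) (U : Set (E d)) :
    (maximalCubes D U).PairwiseDisjoint DyadicCube.toSet := by
  have key : ∀ Q ∈ maximalCubes D U, ∀ R ∈ maximalCubes D U, Q ≠ R → Q.scale ≤ R.scale →
      Disjoint Q.toSet R.toSet := by
    intro Q hQ R hR hne hle
    refine (hD.nested Q hQ.1 R hR.1 hle).resolve_left fun hsub => hne ?_
    exact hD.eq_of_mem_of_mem hQ.1 hR.1 (hle.antisymm (hQ.2.2 R hR.1 hR.2.1 hsub))
      Q.corner_mem_toSet (hsub Q.corner_mem_toSet)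
  intro Q hQ R hR hne
  rcases le_total Q.scale R.scale with h | h
  · exact key Q hQ R hR hne h
  · exact (key R hR Q hQ hne.symm h).symm

/-- A Carleson condition on cubes implies the Carleson condition on arbitrary sets. -/
lemma tsum_subset_le (hD : IsDyadicGrid D) (hd : 1 ≤ d) {b : DyadicCube d → ℝ≥0∞} {C : ℝ≥0∞}
    (hC : C ≠ 0)
    (h : ∀ R ∈ D, ∑' Q : {Q // Q ∈ D ∧ Q.toSet ⊆ R.toSet}, b Q ≤ C * volume R.toSet)
    (U : Set (E d)) :
    ∑' Q : {Q // Q ∈ D ∧ Q.toSet ⊆ U}, b Q ≤ C * volume U := by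
  by_cases hU : volume U = ∞
  · simp [hU, ENNReal.mul_top hC]
  have hcount : (maximalCubes D U).Countable := hD.countable.mono fun R hR => hR.1
  have := hcount.to_subtype
  calc ∑' Q : {Q // Q ∈ D ∧ Q.toSet ⊆ U}, b Q
      ≤ ∑' Q : ⋃ R : maximalCubes D U, {Q | Q ∈ D ∧ Q.toSet ⊆ R.1.toSet}, b Q := by
        refine ENNReal.tsum_mono_subtype (s := {Q | Q ∈ D ∧ Q.toSet ⊆ U}) b fun Q hQ => ?_
        obtain ⟨R, hR, hQR⟩ := exists_maximal hd hU hQ.1 hQ.2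
        exact mem_iUnion.2 ⟨⟨R, hR⟩, hQ.1, hQR⟩
    _ ≤ ∑' R : maximalCubes D U, ∑' Q : {Q | Q ∈ D ∧ Q.toSet ⊆ R.1.toSet}, b Q :=
        ENNReal.tsum_iUnion_le_tsum b _
    _ ≤ ∑' R : maximalCubes D U, C * volume R.1.toSet :=
        ENNReal.tsum_le_tsum fun R => h R.1 R.2.1
    _ = C * volume (⋃ R ∈ maximalCubes D U, R.toSet) := by
        rw [ENNReal.tsum_mul_left, measure_biUnion hcount
          (hD.pairwiseDisjoint_maximalCubes U) fun R _ => R.measurableSet_toSet]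
    _ ≤ C * volume U := by
        gcongr
        exact iUnion₂_subset fun R hR => hR.2.1

end IsDyadicGrid

/-! ### Carleson sums over sets in the product space -/

lemma Admissible.measurableSet {n m : ℕ} {Dn : Set (DyadicCube n)} {Dm : Set (DyadicCube m)}
    (hDn : IsDyadicGrid Dn) (hDm : IsDyadicGrid Dm) {Ω : Set (E n × E m)}
    (hΩ : Admissible Dn Dm Ω) : MeasurableSet Ω := by
  have h : Ω = ⋃ I ∈ Dn, ⋃ J ∈ Dm, ⋃ _ : I.toSet ×ˢ J.toSet ⊆ Ω, I.toSet ×ˢ J.toSet := by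
    refine Subset.antisymm (fun x hx => ?_)
      (iUnion₂_subset fun I _ => iUnion₂_subset fun J _ => iUnion_subset fun h => h)
    obtain ⟨I, hI, J, hJ, hxIJ, hsub⟩ := hΩ.2 x hx
    simp only [mem_iUnion]
    exact ⟨I, hI, J, hJ, hsub, hxIJ⟩
  rw [h]
  exact MeasurableSet.biUnion hDn.countable fun I _ =>
    MeasurableSet.biUnion hDm.countable fun J _ =>
      MeasurableSet.iUnion fun _ => I.measurableSet_toSet.prod J.measurableSet_toSet

/-- Products of one-parameter Carleson sequences are bi-parameter Carleson sequences. -/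
lemma tsum_mul_le_of_carleson {n m : ℕ} {Dn : Set (DyadicCube n)} {Dm : Set (DyadicCube m)}
    (hDn : IsDyadicGrid Dn) (hDm : IsDyadicGrid Dm)
    {a : DyadicCube n → ℝ≥0∞} {b : DyadicCube m → ℝ≥0∞} {C₁ C₂ : ℝ≥0∞}
    (ha : ∀ U : Set (E n), ∑' I : {I // I ∈ Dn ∧ I.toSet ⊆ U}, a I ≤ C₁ * volume U)
    (hb : ∀ U : Set (E m), ∑' J : {J // J ∈ Dm ∧ J.toSet ⊆ U}, b J ≤ C₂ * volume U)
    (hC₁ : C₁ ≠ ∞)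
    {Ω : Set (E n × E m)} (hΩ : MeasurableSet Ω) :
    ∑' R : {R : DyadicCube n × DyadicCube m //
        R.1 ∈ Dn ∧ R.2 ∈ Dm ∧ R.1.toSet ×ˢ R.2.toSet ⊆ Ω}, a R.1.1 * b R.1.2
      ≤ C₁ * C₂ * volume Ω := by
  have := hDn.countable.to_subtype
  have := hDm.countable.to_subtype
  -- For fixed `I`, `{y | P I y}` is the union of the `J` paired with `I` in `Ω`. Relaxing the
  -- condition on `J` to inclusion in this union turns the inner sum into a one-parameter Carleson
  -- sum.
  let P (I : DyadicCube n) (y : E m) : Prop :=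
    ∃ J ∈ Dm, I.toSet ×ˢ J.toSet ⊆ Ω ∧ y ∈ J.toSet
  have hPmeas : ∀ I, MeasurableSet {y | P I y} := by
    intro I
    have : {y | P I y} = ⋃ J ∈ Dm, ⋃ _ : I.toSet ×ˢ J.toSet ⊆ Ω, J.toSet := by
      ext y
      simp only [P, mem_ofPred_eq, mem_iUnion, exists_prop]
    rw [this]
    exact MeasurableSet.biUnion hDm.countable fun J _ =>
      MeasurableSet.iUnion fun _ => J.measurableSet_toSet
  calc ∑' R : {R : DyadicCube n × DyadicCube m //
        R.1 ∈ Dn ∧ R.2 ∈ Dm ∧ R.1.toSet ×ˢ R.2.toSet ⊆ Ω}, a R.1.1 * b R.1.2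
      ≤ ∑' R : (Σ I : Dn, {J // J ∈ Dm ∧ J.toSet ⊆ {y | P I y}}), a R.1 * b R.2 := by
        let φ : {R : DyadicCube n × DyadicCube m //
            R.1 ∈ Dn ∧ R.2 ∈ Dm ∧ R.1.toSet ×ˢ R.2.toSet ⊆ Ω} →
            (Σ I : Dn, {J // J ∈ Dm ∧ J.toSet ⊆ {y | P I y}}) := fun R =>
          ⟨⟨R.1.1, R.2.1⟩, ⟨R.1.2, R.2.2.1, fun y hy => ⟨R.1.2, R.2.2.1, R.2.2.2, hy⟩⟩⟩
        have hφ : Function.Injective φ := by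
          intro R R' h
          have h1 : R.1.1 = R'.1.1 := congrArg (fun S => (S.1 : DyadicCube n)) h
          have h2 : R.1.2 = R'.1.2 := congrArg (fun S => (S.2 : DyadicCube m)) h
          exact Subtype.ext (Prod.ext h1 h2)
        exact ENNReal.tsum_comp_le_tsum_of_injective hφ
          (fun R : (Σ I : Dn, {J // J ∈ Dm ∧ J.toSet ⊆ {y | P I y}}) => a R.1 * b R.2)
    _ = ∑' I : Dn, a I * ∑' J : {J // J ∈ Dm ∧ J.toSet ⊆ {y | P I y}}, b J := by
        rw [ENNReal.tsum_sigma']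
        simp_rw [ENNReal.tsum_mul_left]
    _ ≤ ∑' I : Dn, a I * (C₂ * volume {y | P I y}) :=
        ENNReal.tsum_le_tsum fun I => mul_le_mul_right (hb _) _
    _ = C₂ * ∑' I : Dn, ∫⁻ y, {y | P I y}.indicator (fun _ => a I) y := by
        rw [← ENNReal.tsum_mul_left]
        refine tsum_congr fun I => ?_
        rw [lintegral_indicator_const (hPmeas I)]
        ring
    _ = C₂ * ∫⁻ y, ∑' I : Dn, {y | P I y}.indicator (fun _ => a I) y := by
        rw [lintegral_tsum fun I : Dn => (measurable_const.indicator (hPmeas I)).aemeasurable]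
    _ ≤ C₂ * ∫⁻ y, C₁ * volume ((fun x => (x, y)) ⁻¹' Ω) := by
        -- If `P I y` holds, then `I × {y}` lies in `Ω`, so only cubes inside the slice at height
        -- `y` contribute.
        gcongr with y
        refine le_trans ?_ (ha _)
        rw [tsum_subtype Dn fun I => {y | P I y}.indicator (fun _ => a I) y,
          show ∑' I : {I // I ∈ Dn ∧ I.toSet ⊆ (fun x => (x, y)) ⁻¹' Ω}, a I = _ from
            tsum_subtype {I | I ∈ Dn ∧ I.toSet ⊆ (fun x => (x, y)) ⁻¹' Ω} a]
        refine ENNReal.tsum_le_tsum fun I => ?_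
        by_cases hI : I ∈ Dn
        · by_cases hP : P I y
          · obtain ⟨J, hJ, hsub, hy⟩ := id hP
            have : I ∈ {I | I ∈ Dn ∧ I.toSet ⊆ (fun x => (x, y)) ⁻¹' Ω} :=
              ⟨hI, fun x hx => hsub ⟨hx, hy⟩⟩
            rw [indicator_of_mem hI, indicator_of_mem (show y ∈ {y | P I y} from hP),
              indicator_of_mem this]
          · rw [indicator_of_mem hI, indicator_of_notMem (show y ∉ {y | P I y} from hP)]
            exact zero_le
        · rw [indicator_of_notMem hI]
          exact zero_le
    _ = C₁ * C₂ * volume Ω := by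
        rw [lintegral_const_mul' _ _ hC₁, Measure.volume_eq_prod, Measure.prod_apply_symm hΩ]
        ring

/-! ### Poisson-type kernels -/

/-- The radial profile `t ^ a / (t + r) ^ (d + a)`. -/
def decay (d : ℕ) (a t r : ℝ) : ℝ := t ^ a / (t + r) ^ ((d : ℝ) + a)

/-- The integral of `y ↦ decay d a t ‖x - y‖`, which does not depend on `t` and `x`. -/
def decayMass (d : ℕ) (a : ℝ) : ℝ≥0∞ := ∫⁻ u : E d, ENNReal.ofReal (decay d a 1 ‖u‖)

variable {d : ℕ} {a t r ρ : ℝ}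

lemma decayMass_ne_top (ha : 0 < a) : decayMass d a ≠ ∞ := by
  have h := finite_integral_one_add_norm (E := E d) (μ := volume) (r := (d : ℝ) + a)
    (by simpa using ha)
  refine ne_of_eq_of_ne (lintegral_congr fun u => ?_) h.ne
  rw [decay, Real.one_rpow, one_div, Real.rpow_neg (by positivity)]

lemma decay_eq_scale (ht : 0 < t) (hr : 0 ≤ r) :
    decay d a t r = (t ^ d)⁻¹ * decay d a 1 (t⁻¹ * r) := by
  have h1 : 1 + t⁻¹ * r = (t + r) / t := by field_simp
  rw [decay, decay, h1, Real.div_rpow (by positivity) ht.le, Real.rpow_add ht, Real.rpow_natCast,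
    Real.one_rpow]
  have : (t + r) ^ ((d : ℝ) + a) ≠ 0 := by positivity
  field_simp

lemma lintegral_decay (ht : 0 < t) (x : E d) :
    ∫⁻ y, ENNReal.ofReal (decay d a t ‖x - y‖) = decayMass d a := by
  have hmeas : Measurable fun u : E d => ENNReal.ofReal (decay d a 1 ‖u‖) := by
    unfold decay; fun_prop
  rw [lintegral_sub_left_eq_self (μ := volume)
    (fun u : E d => ENNReal.ofReal (decay d a t ‖u‖)) x]
  have h1 : ∀ u : E d, ENNReal.ofReal (decay d a t ‖u‖) =
      ENNReal.ofReal (t ^ d)⁻¹ * ENNReal.ofReal (decay d a 1 ‖t⁻¹ • u‖) := by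
    intro u
    rw [norm_smul, Real.norm_of_nonneg (inv_nonneg.2 ht.le), decay_eq_scale ht (norm_nonneg _),
      ENNReal.ofReal_mul (by positivity)]
  simp_rw [h1]
  rw [lintegral_const_mul' _ _ ENNReal.ofReal_ne_top,
    ← lintegral_map hmeas (measurable_const_smul t⁻¹),
    Measure.map_addHaar_smul volume (inv_ne_zero ht.ne'), lintegral_smul_measure, smul_eq_mul,
    ← mul_assoc, ← ENNReal.ofReal_mul (by positivity), decayMass]
  have : (t ^ d)⁻¹ * |((t⁻¹) ^ Module.finrank ℝ (E d))⁻¹| = 1 := by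
    rw [Module.finrank_fin_fun, abs_of_nonneg (by positivity), inv_pow, inv_inv]
    field_simp
  rw [this, ENNReal.ofReal_one, one_mul]

/-- Half of the exponent `a` is spent on smallness beyond distance `ρ`; the other half keeps the
kernel integrable when `a > 0`. -/
lemma decay_le_of_le (ha : 0 ≤ a) (ht : 0 < t) (hρ : 0 < ρ) (hr : ρ ≤ r) :
    decay d a t r ≤ (t / ρ) ^ (a / 2) * decay d (a / 2) t r := by
  have hr0 : 0 < r := hρ.trans_le hr
  have h1 : (t + r) ^ ((d : ℝ) + a) = (t + r) ^ (a / 2) * (t + r) ^ ((d : ℝ) + a / 2) := by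
    rw [← Real.rpow_add (by positivity)]; ring_nf
  have h2 : t ^ a = t ^ (a / 2) * t ^ (a / 2) := by
    rw [← Real.rpow_add ht]; ring_nf
  rw [decay, decay, h1, h2, mul_div_mul_comm, Real.div_rpow ht.le hρ.le]
  gcongr
  linarith

/-- In this form the condition `λ > 1` says, for `d ≥ 1`, that the decay exponent is positive; the
factor `t⁻¹` is the density of `dt / t`. -/
lemma gWeight_eq (ht : 0 < t) (lam : ℝ) (x y : E d) :
    gWeight d lam t x y = t⁻¹ * decay d (d * (lam - 1)) t ‖x - y‖ := by
  have h1 : (d : ℝ) + d * (lam - 1) = d * lam := by ring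
  have h2 : t ^ ((d : ℝ) * (lam - 1)) = t ^ ((d : ℝ) * lam) / t ^ d := by
    rw [← Real.rpow_natCast t d, ← Real.rpow_sub ht]; ring_nf
  have h3 : (t + ‖x - y‖) ^ ((d : ℝ) * lam) ≠ 0 := by positivity
  rw [gWeight, decay, h1, h2, Real.div_rpow ht.le (by positivity), pow_succ]
  field_simp

lemma lintegral_gWeight (ht : 0 < t) (lam : ℝ) (x : E d) :
    ∫⁻ y, ENNReal.ofReal (gWeight d lam t x y) =
      ENNReal.ofReal t⁻¹ * decayMass d (d * (lam - 1)) := by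
  simp_rw [gWeight_eq ht, ENNReal.ofReal_mul (inv_nonneg.2 ht.le)]
  rw [lintegral_const_mul' _ _ ENNReal.ofReal_ne_top, lintegral_decay ht]

/-! ### Pointwise bounds for `θ_t` -/

variable {s : ℝ → E d → E d → ℂ} {α lam : ℝ} {A B : ℝ≥0}

lemma SizeCondition.enorm_theta_le (hs : SizeCondition α A s) (ht : 0 < t) {f : E d → ℂ}
    (hf : ∀ z, ‖f z‖ ≤ 1) (y : E d) : ‖theta s t f y‖ₑ ≤ A * decayMass d α := by
  calc ‖theta s t f y‖ₑ ≤ ∫⁻ z, ‖s t y z * f z‖ₑ := enorm_integral_le_lintegral_enorm _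
    _ ≤ ∫⁻ z, A * ENNReal.ofReal (decay d α t ‖y - z‖) := by
        refine lintegral_mono fun z => ?_
        rw [← ofReal_norm, ← ENNReal.ofReal_coe_nnreal, ← ENNReal.ofReal_mul A.coe_nonneg, norm_mul]
        exact ENNReal.ofReal_le_ofReal
          ((mul_le_of_le_one_right (norm_nonneg _) (hf z)).trans (hs t ht y z))
    _ = A * decayMass d α := by
        rw [lintegral_const_mul' _ _ ENNReal.coe_ne_top, lintegral_decay ht]

lemma SizeCondition.enorm_theta_le_of_dist (hs : SizeCondition α A s) (hα : 0 ≤ α) (ht : 0 < t)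
    (hρ : 0 < ρ) {f : E d → ℂ} (hf : ∀ z, ‖f z‖ ≤ 1) {y : E d}
    (hfy : ∀ z, ‖y - z‖ < ρ → f z = 0) :
    ‖theta s t f y‖ₑ ≤ A * decayMass d (α / 2) * ENNReal.ofReal ((t / ρ) ^ (α / 2)) := by
  calc ‖theta s t f y‖ₑ ≤ ∫⁻ z, ‖s t y z * f z‖ₑ := enorm_integral_le_lintegral_enorm _
    _ ≤ ∫⁻ z, (A * ENNReal.ofReal ((t / ρ) ^ (α / 2))) *
          ENNReal.ofReal (decay d (α / 2) t ‖y - z‖) := by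
        refine lintegral_mono fun z => ?_
        rcases lt_or_ge ‖y - z‖ ρ with h | h
        · simp [hfy z h]
        · rw [← ofReal_norm, ← ENNReal.ofReal_coe_nnreal, ← ENNReal.ofReal_mul A.coe_nonneg,
            ← ENNReal.ofReal_mul (by positivity), norm_mul]
          refine ENNReal.ofReal_le_ofReal
            ((mul_le_of_le_one_right (norm_nonneg _) (hf z)).trans ((hs t ht y z).trans ?_))
          rw [mul_assoc]
          exact mul_le_mul_of_nonneg_left (decay_le_of_le hα ht hρ h) A.coe_nonneg
    _ = A * decayMass d (α / 2) * ENNReal.ofReal ((t / ρ) ^ (α / 2)) := by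
        rw [lintegral_const_mul' _ _ (by finiteness), lintegral_decay ht]
        ring

/-- An inequality suffices and needs no integrability: if `s t y` is not integrable, the left side
is the default value `0`. -/
lemma enorm_theta_one_le {S : Set (E d)} (hS : MeasurableSet S) (t : ℝ) (y : E d) :
    ‖theta s t (fun _ => 1) y‖ₑ ≤
      ‖theta s t (S.indicator 1) y‖ₑ + ‖theta s t (Sᶜ.indicator 1) y‖ₑ := by
  by_cases hint : Integrable fun z => s t y z
  · have key : ∀ T : Set (E d), (fun z => s t y z * T.indicator 1 z) = T.indicator (s t y) := by
      intro T
      ext z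
      by_cases hz : z ∈ T <;> simp [hz]
    have : theta s t (fun _ => 1) y =
        theta s t (S.indicator 1) y + theta s t (Sᶜ.indicator 1) y := by
      simp only [theta, key, mul_one]
      rw [← integral_add (hint.indicator hS) (hint.indicator hS.compl)]
      exact integral_congr_ae (.of_forall fun z =>
        (congrFun (indicator_self_add_compl S (s t y)) z).symm)
    rw [this]
    exact enorm_add_le _ _
  · rw [theta, integral_undef (by simpa using hint)]
    simp

lemma norm_indicator_one_le (S : Set (E d)) (z : E d) : ‖S.indicator (1 : E d → ℂ) z‖ ≤ 1 := by
  by_cases hz : z ∈ S <;> simp [hz]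

/-- The part of `θ_t 1` coming from points at distance at least `2 ρ` from `x`. The summand `g` is
there because `θ_t` applied to a function need not be measurable for every `t`. -/
lemma SizeCondition.lintegral_far_le (hs : SizeCondition α A s) (hα : 0 ≤ α) (hlam : 1 ≤ lam)
    (ht : 0 < t) (hρ : 0 < ρ) {S : Set (E d)} {x : E d} (hS : ∀ z ∈ S, 2 * ρ ≤ ‖x - z‖)
    (g : E d → ℝ≥0∞) :
    ∫⁻ y, (g y +
        ‖theta s t (S.indicator 1) y‖ₑ ^ 2 * ENNReal.ofReal (gWeight d lam t x y)) ≤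
      (∫⁻ y, g y) + ((A * decayMass d (α / 2)) ^ 2 * decayMass d (d * (lam - 1)) *
          ENNReal.ofReal ((t / ρ) ^ α * t⁻¹) +
        (A * decayMass d α) ^ 2 * decayMass d (d * (lam - 1) / 2) *
          ENNReal.ofReal ((t / ρ) ^ (d * (lam - 1) / 2) * t⁻¹)) := by
  set b : ℝ := d * (lam - 1)
  have hb : 0 ≤ b := mul_nonneg d.cast_nonneg (by linarith)
  set c₁ := A * decayMass d (α / 2) * ENNReal.ofReal ((t / ρ) ^ (α / 2))
  set c₂ := A * decayMass d α
  have hpt : ∀ y, ‖theta s t (S.indicator 1) y‖ₑ ^ 2 * ENNReal.ofReal (gWeight d lam t x y) ≤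
      c₁ ^ 2 * ENNReal.ofReal (gWeight d lam t x y) +
        c₂ ^ 2 * (ENNReal.ofReal ((t / ρ) ^ (b / 2) * t⁻¹) *
          ENNReal.ofReal (decay d (b / 2) t ‖x - y‖)) := by
    intro y
    -- If `y` is within `ρ` of `x`, it is at least `ρ` away from `S`, and `θ_t` is small. Otherwise
    -- the weight is small and the uniform bound on `θ_t` is enough.
    rcases lt_or_ge ‖x - y‖ ρ with h | h
    · refine le_add_right ?_
      gcongr
      refine hs.enorm_theta_le_of_dist hα ht hρ (norm_indicator_one_le S) fun z hz => ?_
      refine indicator_of_notMem (fun hzS => ?_) _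
      have h1 := hS z hzS
      have h2 := norm_sub_le_norm_sub_add_norm_sub x y z
      linarith
    · refine le_add_left ?_
      gcongr
      · exact hs.enorm_theta_le ht (norm_indicator_one_le S) y
      · rw [← ENNReal.ofReal_mul (by positivity), gWeight_eq ht]
        refine ENNReal.ofReal_le_ofReal ?_
        have := mul_le_mul_of_nonneg_left (decay_le_of_le (d := d) hb ht hρ h)
          (inv_nonneg.2 ht.le)
        linarith
  have hmeas : Measurable fun y : E d => c₁ ^ 2 * ENNReal.ofReal (gWeight d lam t x y) := by
    unfold gWeight; fun_prop
  have hmeas2 : Measurable fun y : E d => ENNReal.ofReal (gWeight d lam t x y) := by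
    unfold gWeight; fun_prop
  have hmeas3 : Measurable fun y : E d => ENNReal.ofReal (decay d (b / 2) t ‖x - y‖) := by
    unfold decay; fun_prop
  have hmeas4 : Measurable fun y : E d => c₁ ^ 2 * ENNReal.ofReal (gWeight d lam t x y) +
      c₂ ^ 2 * (ENNReal.ofReal ((t / ρ) ^ (b / 2) * t⁻¹) *
        ENNReal.ofReal (decay d (b / 2) t ‖x - y‖)) :=
    hmeas.add ((hmeas3.const_mul _).const_mul _)
  refine (lintegral_mono fun y => add_le_add_right (hpt y) (g y)).trans_eq ?_
  rw [lintegral_add_right g hmeas4]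
  congr 1
  rw [lintegral_add_left hmeas, lintegral_const_mul _ hmeas2, lintegral_gWeight ht,
    lintegral_const_mul _ (hmeas3.const_mul _), lintegral_const_mul _ hmeas3, lintegral_decay ht]
  congr 1
  · have : (t / ρ) ^ α = (t / ρ) ^ (α / 2) * (t / ρ) ^ (α / 2) := by
      rw [← Real.rpow_add (by positivity)]; ring_nf
    rw [this, ENNReal.ofReal_mul (by positivity), ENNReal.ofReal_mul (by positivity)]
    simp only [c₁]
    ring
  · ring

/-! ### The one-parameter Carleson condition -/

/-- `∫ |θ_t 1(y)|² (t / (t + |x - y|)) ^ (d λ) dy / t ^ (d + 1)` as a function of `(x, t)`. -/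
def carlesonDensity (lam : ℝ) (s : ℝ → E d → E d → ℂ) (p : E d × ℝ) : ℝ≥0∞ :=
  ∫⁻ y, ‖theta s p.2 (fun _ => 1) y‖ₑ ^ 2 * ENNReal.ofReal (gWeight d lam p.2 p.1 y)

/-- The one-parameter Carleson coefficient. -/
def whitneyMass (lam : ℝ) (s : ℝ → E d → E d → ℂ) (I : DyadicCube d) : ℝ≥0∞ :=
  ∫⁻ p in I.whitney, carlesonDensity lam s p

lemma KernelMeasurable.theta_aestronglyMeasurable (hs : KernelMeasurable s) {f : E d → ℂ}
    (hf : Measurable f) :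
    AEStronglyMeasurable (fun p : E d × ℝ => theta s p.2 f p.1)
      ((volume : Measure (E d)).prod (volume.restrict (Ioi 0))) := by
  have h1 : AEStronglyMeasurable (fun p : (ℝ × E d) × E d => s p.1.1 p.1.2 p.2 * f p.2)
      (((volume.restrict (Ioi (0 : ℝ))).prod volume).prod volume) := by
    refine AEStronglyMeasurable.mul ?_
      (hf.comp measurable_snd).stronglyMeasurable.aestronglyMeasurable
    exact AEStronglyMeasurable.comp_measurePreserving hs
      (measurePreserving_prodAssoc (volume.restrict (Ioi (0 : ℝ))) volume volume)
  exact (h1.integral_prod_right').prod_swap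

lemma lintegral_gStar_sq_le (hB : GStarL2Bound lam B s) {S : Set (E d)} (hS : MeasurableSet S)
    (hvol : volume S ≠ ∞) :
    ∫⁻ x, gStar lam s (S.indicator 1) x ^ 2 ≤ B ^ 2 * volume S := by
  have hmem : MemLp (S.indicator (1 : E d → ℂ)) 2 volume :=
    memLp_indicator_const 2 hS 1 (Or.inr hvol)
  have h := hB _ hmem
  have h1 : eLpNorm (S.indicator (1 : E d → ℂ)) 2 volume = volume S ^ (1 / 2 : ℝ) := by
    refine (eLpNorm_indicator_const (c := (1 : ℂ)) hS two_ne_zero ENNReal.ofNat_ne_top).trans ?_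
    simp
  rw [h1, eLpNorm_eq_lintegral_rpow_enorm_toReal two_ne_zero ENNReal.ofNat_ne_top] at h
  have h2 := ENNReal.rpow_le_rpow h (z := 2) zero_le_two
  rw [← ENNReal.rpow_mul, ENNReal.mul_rpow_of_nonneg _ _ zero_le_two, ← ENNReal.rpow_mul] at h2
  simpa using h2

/-- The order of integration changes from `(x, t)` outside and `y` inside to `x` outside and `(y,
t)` inside. `lintegral_prod_le` needs no measurability; for fixed `x`, Tonelli uses the joint
measurability of `theta` in `(y, t)`. -/
lemma lintegral_near_le (hs : KernelMeasurable s) {f : E d → ℂ} (hf : Measurable f) :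
    ∫⁻ p in (univ : Set (E d)) ×ˢ Ioi (0 : ℝ),
        ∫⁻ y, ‖theta s p.2 f y‖ₑ ^ 2 * ENNReal.ofReal (gWeight d lam p.2 p.1 y) ≤
      ∫⁻ x, gStar lam s f x ^ 2 := by
  have hprod : (volume : Measure (E d × ℝ)).restrict (univ ×ˢ Ioi (0 : ℝ)) =
      (volume : Measure (E d)).prod (volume.restrict (Ioi 0)) := by
    rw [Measure.volume_eq_prod, ← Measure.prod_restrict, Measure.restrict_univ]
  rw [hprod]
  refine (lintegral_prod_le _).trans (lintegral_mono fun x => ?_)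
  have hmeas : AEMeasurable (fun p : E d × ℝ => ‖theta s p.2 f p.1‖ₑ ^ 2 *
      ENNReal.ofReal (gWeight d lam p.2 x p.1))
      ((volume : Measure (E d)).prod (volume.restrict (Ioi 0))) := by
    have hw : Measurable fun p : E d × ℝ => ENNReal.ofReal (gWeight d lam p.2 x p.1) := by
      unfold gWeight; fun_prop
    exact ((hs.theta_aestronglyMeasurable hf).enorm.pow_const 2).mul hw.aemeasurable
  have hg : gStar lam s f x ^ 2 = ∫⁻ p : E d × ℝ, ‖theta s p.2 f p.1‖ₑ ^ 2 *
      ENNReal.ofReal (gWeight d lam p.2 x p.1)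
        ∂((volume : Measure (E d)).prod (volume.restrict (Ioi 0))) := by
    rw [gStar, hprod, ← ENNReal.rpow_natCast, ← ENNReal.rpow_mul]
    norm_num
  rw [hg, lintegral_prod_symm _ hmeas]

lemma lintegral_Ioo_rpow_div {a ℓ : ℝ} (ha : 0 < a) (hℓ : 0 < ℓ) :
    ∫⁻ t in Ioo 0 ℓ, ENNReal.ofReal ((t / (ℓ / 2)) ^ a * t⁻¹) = ENNReal.ofReal (2 ^ a / a) := by
  have h1 : ∀ t ∈ Ioo 0 ℓ, (t / (ℓ / 2)) ^ a * t⁻¹ = (2 / ℓ) ^ a * t ^ (a - 1) := by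
    intro t ht
    have : t / (ℓ / 2) = 2 / ℓ * t := by field_simp
    rw [this, Real.mul_rpow (by positivity) ht.1.le, Real.rpow_sub_one ht.1.ne', mul_assoc,
      div_eq_mul_inv (t ^ a)]
  have hint : IntegrableOn (fun t : ℝ => (2 / ℓ) ^ a * t ^ (a - 1)) (Ioo 0 ℓ) :=
    IntegrableOn.mono_set (((intervalIntegral.intervalIntegrable_rpow' (by linarith)).1).const_mul _)
      Ioo_subset_Ioc_self
  rw [setLIntegral_congr_fun measurableSet_Ioo fun t ht => by rw [h1 t ht],
    ← ofReal_integral_eq_lintegral_ofReal hint]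
  · congr 1
    rw [integral_const_mul, ← integral_Ioc_eq_integral_Ioo,
      ← intervalIntegral.integral_of_le hℓ.le, integral_rpow (Or.inl (by linarith)),
      sub_add_cancel, Real.zero_rpow ha.ne', sub_zero, Real.div_rpow zero_le_two hℓ.le]
    field_simp
  · filter_upwards [ae_restrict_mem measurableSet_Ioo] with t ht
    have := ht.1
    positivity

/-- The constant in the one-parameter Carleson condition. -/
def carlesonConst (d : ℕ) (α lam : ℝ) (A B : ℝ≥0) : ℝ≥0∞ :=
  4 * (B ^ 2 * 4 ^ d +
    ((A * decayMass d (α / 2)) ^ 2 * decayMass d (d * (lam - 1)) * ENNReal.ofReal (2 ^ α / α) +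
      (A * decayMass d α) ^ 2 * decayMass d (d * (lam - 1) / 2) *
        ENNReal.ofReal (2 ^ (d * (lam - 1) / 2) / (d * (lam - 1) / 2)))) + 1

/-- The summand `1` of the constant serves this purpose: `tsum_subset_le` needs a nonzero constant
for sets of infinite measure. -/
lemma carlesonConst_ne_zero : carlesonConst d α lam A B ≠ 0 := by
  simp [carlesonConst]

lemma carlesonConst_ne_top (hd : 1 ≤ d) (hα : 0 < α) (hlam : 1 < lam) :
    carlesonConst d α lam A B ≠ ∞ := by
  have hb : 0 < d * (lam - 1) := mul_pos (by exact_mod_cast hd) (by linarith)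
  have h1 := decayMass_ne_top (d := d) hα
  have h2 := decayMass_ne_top (d := d) (half_pos hα)
  have h3 := decayMass_ne_top (d := d) hb
  have h4 := decayMass_ne_top (d := d) (half_pos hb)
  unfold carlesonConst
  finiteness

lemma add_sq_le_four_mul (a b : ℝ≥0∞) : (a + b) ^ 2 ≤ 4 * (a ^ 2 + b ^ 2) := by
  have key : ∀ a b : ℝ≥0∞, a ≤ b → (a + b) ^ 2 ≤ 4 * (a ^ 2 + b ^ 2) := by
    intro a b hab
    calc (a + b) ^ 2 ≤ (b + b) ^ 2 := by gcongr
      _ = 4 * b ^ 2 := by ring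
      _ ≤ 4 * (a ^ 2 + b ^ 2) := by gcongr; exact le_add_self
  rcases le_total a b with h | h
  · exact key a b h
  · rw [add_comm a, add_comm (a ^ 2)]
    exact key b a h

lemma setLIntegral_carlesonDensity_le (hd : 1 ≤ d) (hα : 0 < α) (hlam : 1 < lam)
    (hm : KernelMeasurable s) (hs : SizeCondition α A s) (hB : GStarL2Bound lam B s)
    (R : DyadicCube d) :
    ∫⁻ p in R.toSet ×ˢ Ioo 0 R.side, carlesonDensity lam s p ≤
      carlesonConst d α lam A B * volume R.toSet := by
  set b : ℝ := d * (lam - 1)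
  have hb : 0 < b := mul_pos (by exact_mod_cast hd) (by linarith)
  -- Points of `R` are within `ℓ(R)` of the corner, so points outside `S` are at distance at least
  -- `ℓ(R) = 2ρ` from `R`, with `ρ = ℓ(R) / 2`. The `ℓ^∞` ball is a cube of side `4 ℓ(R)`, whence
  -- the factor `4 ^ d`.
  set S : Set (E d) := Metric.closedBall R.corner (2 * R.side)
  have hS : MeasurableSet S := measurableSet_closedBall
  have hvolS : volume S = 4 ^ d * volume R.toSet := by
    have h0 := R.side_pos
    rw [Real.volume_pi_closedBall _ (by positivity), R.volume_toSet, Fintype.card_fin,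
      show 2 * (2 * R.side) = 4 * R.side by ring, mul_pow, ENNReal.ofReal_mul (by positivity),
      ENNReal.ofReal_pow zero_le_four, ENNReal.ofReal_ofNat]
  have hdist : ∀ x ∈ R.toSet, ∀ z ∈ Sᶜ, 2 * (R.side / 2) ≤ ‖x - z‖ := by
    intro x hx z hz
    have h1 := R.norm_sub_corner_le hx
    have h2 : 2 * R.side < ‖z - R.corner‖ := by
      simpa [S, dist_eq_norm] using hz
    have h3 := norm_sub_le_norm_sub_add_norm_sub z x R.corner
    rw [norm_sub_rev z x] at h3
    linarith
  set K₁ := (A * decayMass d (α / 2)) ^ 2 * decayMass d b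
  set K₂ := (A * decayMass d α) ^ 2 * decayMass d (b / 2)
  let F (t : ℝ) : ℝ≥0∞ := K₁ * ENNReal.ofReal ((t / (R.side / 2)) ^ α * t⁻¹) +
    K₂ * ENNReal.ofReal ((t / (R.side / 2)) ^ (b / 2) * t⁻¹)
  have hm₁ : Measurable fun t : ℝ => ENNReal.ofReal ((t / (R.side / 2)) ^ α * t⁻¹) := by fun_prop
  have hm₂ : Measurable fun t : ℝ => ENNReal.ofReal ((t / (R.side / 2)) ^ (b / 2) * t⁻¹) := by
    fun_prop
  have hF : Measurable F := (hm₁.const_mul _).add (hm₂.const_mul _)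
  let G (f : E d → ℂ) (p : E d × ℝ) : ℝ≥0∞ :=
    ∫⁻ y, ‖theta s p.2 f y‖ₑ ^ 2 * ENNReal.ofReal (gWeight d lam p.2 p.1 y)
  have hpt : ∀ p ∈ R.toSet ×ˢ Ioo 0 R.side,
      carlesonDensity lam s p ≤ 4 * (G (S.indicator 1) p + F p.2) := by
    rintro ⟨x, t⟩ ⟨hx, ht⟩
    calc carlesonDensity lam s (x, t)
        ≤ ∫⁻ y, 4 * (‖theta s t (S.indicator 1) y‖ₑ ^ 2 * ENNReal.ofReal (gWeight d lam t x y) +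
            ‖theta s t (Sᶜ.indicator 1) y‖ₑ ^ 2 * ENNReal.ofReal (gWeight d lam t x y)) := by
          refine lintegral_mono fun y => ?_
          rw [← add_mul, ← mul_assoc]
          gcongr
          refine le_trans ?_ (add_sq_le_four_mul _ _)
          gcongr
          exact enorm_theta_one_le hS t y
      _ ≤ 4 * (G (S.indicator 1) (x, t) + F t) := by
          rw [lintegral_const_mul' _ _ ENNReal.ofNat_ne_top]
          gcongr
          exact hs.lintegral_far_le hα.le hlam.le ht.1 (half_pos R.side_pos) (hdist x hx) _
  have hnear : ∫⁻ p in R.toSet ×ˢ Ioo 0 R.side, G (S.indicator 1) p ≤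
      B ^ 2 * 4 ^ d * volume R.toSet := by
    have hsub : R.toSet ×ˢ Ioo 0 R.side ⊆ univ ×ˢ Ioi 0 :=
      prod_mono (subset_univ _) Ioo_subset_Ioi_self
    refine (lintegral_mono_set hsub).trans
      ((lintegral_near_le hm (measurable_one.indicator hS)).trans ?_)
    rw [mul_assoc, ← hvolS]
    exact lintegral_gStar_sq_le hB hS measure_closedBall_lt_top.ne
  have hfar : ∫⁻ p in R.toSet ×ˢ Ioo 0 R.side, F p.2 ≤
      (K₁ * ENNReal.ofReal (2 ^ α / α) + K₂ * ENNReal.ofReal (2 ^ (b / 2) / (b / 2))) *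
        volume R.toSet := by
    rw [Measure.volume_eq_prod, ← Measure.prod_restrict]
    refine (lintegral_prod_le _).trans_eq ?_
    change ∫⁻ _ in R.toSet, ∫⁻ t in Ioo 0 R.side, F t = _
    rw [lintegral_const, Measure.restrict_apply_univ, lintegral_add_left (hm₁.const_mul _),
      lintegral_const_mul _ hm₁, lintegral_const_mul _ hm₂, lintegral_Ioo_rpow_div hα R.side_pos,
      lintegral_Ioo_rpow_div (half_pos hb) R.side_pos]
  calc ∫⁻ p in R.toSet ×ˢ Ioo 0 R.side, carlesonDensity lam s p
      ≤ ∫⁻ p in R.toSet ×ˢ Ioo 0 R.side, 4 * (G (S.indicator 1) p + F p.2) :=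
        setLIntegral_mono' (R.measurableSet_toSet.prod measurableSet_Ioo) hpt
    _ = 4 * ((∫⁻ p in R.toSet ×ˢ Ioo 0 R.side, G (S.indicator 1) p) +
          ∫⁻ p in R.toSet ×ˢ Ioo 0 R.side, F p.2) := by
        have hF' : Measurable fun p : E d × ℝ => F p.2 := hF.comp measurable_snd
        rw [lintegral_const_mul' _ _ ENNReal.ofNat_ne_top, lintegral_add_right _ hF']
    _ ≤ 4 * (B ^ 2 * 4 ^ d * volume R.toSet +
          (K₁ * ENNReal.ofReal (2 ^ α / α) + K₂ * ENNReal.ofReal (2 ^ (b / 2) / (b / 2))) *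
            volume R.toSet) := by gcongr
    _ ≤ carlesonConst d α lam A B * volume R.toSet := by
        rw [← add_mul, ← mul_assoc]
        gcongr
        exact le_self_add

lemma tsum_whitneyMass_le (hd : 1 ≤ d) (hα : 0 < α) (hlam : 1 < lam)
    (hm : KernelMeasurable s) (hs : SizeCondition α A s) (hB : GStarL2Bound lam B s)
    {D : Set (DyadicCube d)} (hD : IsDyadicGrid D) (U : Set (E d)) :
    ∑' Q : {Q // Q ∈ D ∧ Q.toSet ⊆ U}, whitneyMass lam s Q ≤
      carlesonConst d α lam A B * volume U := by
  refine hD.tsum_subset_le hd carlesonConst_ne_zero (fun R _ => ?_) U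
  have hcount : {Q | Q ∈ D ∧ Q.toSet ⊆ R.toSet}.Countable := hD.countable.mono fun Q hQ => hQ.1
  have : Countable {Q // Q ∈ D ∧ Q.toSet ⊆ R.toSet} := hcount.to_subtype
  unfold whitneyMass
  -- The Whitney regions of the subcubes of `R` are disjoint and lie in the Carleson box `R × (0,
  -- ℓ(R))`.
  rw [← lintegral_iUnion (fun Q => Q.1.measurableSet_whitney) fun Q Q' hne =>
    hD.disjoint_whitney Q.2.1 Q'.2.1 fun h => hne (Subtype.ext h)]
  refine (lintegral_mono_set (iUnion_subset fun Q => ?_)).trans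
    (setLIntegral_carlesonDensity_le hd hα hlam hm hs hB R)
  refine prod_mono Q.2.2 fun t ht => ⟨(half_pos Q.1.side_pos).trans ht.1, ht.2.trans_le ?_⟩
  exact DyadicCube.side_le_side (DyadicCube.scale_le_of_toSet_subset hd Q.2.2)

/-- Finite factors can be pulled out of a lower integral without any measurability of the integrand.
-/
lemma SizeCondition.carlesonDensity_ne_top (hd : 1 ≤ d) (hα : 0 < α) (hlam : 1 < lam)
    (hs : SizeCondition α A s) {p : E d × ℝ} (hp : 0 < p.2) :
    carlesonDensity lam s p ≠ ∞ := by
  have hb : 0 < d * (lam - 1) := mul_pos (by exact_mod_cast hd) (by linarith)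
  have h1 := decayMass_ne_top (d := d) hα
  have h2 := decayMass_ne_top (d := d) hb
  have h : carlesonDensity lam s p ≤ (A * decayMass d α) ^ 2 *
      (ENNReal.ofReal p.2⁻¹ * decayMass d (d * (lam - 1))) := by
    rw [← lintegral_gWeight hp lam p.1, ← lintegral_const_mul' _ _ (by finiteness)]
    refine lintegral_mono fun y => ?_
    gcongr
    exact hs.enorm_theta_le hp (fun _ => by simp) y
  exact ne_top_of_le_ne_top (by finiteness) h

/-! ### Tensor products -/

lemma biTheta_tensorKernel_one {n m : ℕ} (sn : ℝ → E n → E n → ℂ) (sm : ℝ → E m → E m → ℂ)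
    (t₁ t₂ : ℝ) (y : E n × E m) :
    biTheta (tensorKernel sn sm) t₁ t₂ (fun _ => 1) y =
      theta sn t₁ (fun _ => 1) y.1 * theta sm t₂ (fun _ => 1) y.2 := by
  simp only [biTheta, tensorKernel, theta, mul_one]
  exact integral_prod_mul (sn t₁ y.1) (sm t₂ y.2)

lemma gWeight_nonneg {t : ℝ} (ht : 0 < t) (x y : E d) : 0 ≤ gWeight d lam t x y := by
  unfold gWeight; positivity

/-- Only `≤` is claimed, because `lintegral_prod_le` avoids measurability of `θ_t 1` at each fixed
`t`. -/
lemma carlesonCoeff_tensorKernel_le {n m : ℕ} {lam₁ lam₂ : ℝ} {sn : ℝ → E n → E n → ℂ}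
    {sm : ℝ → E m → E m → ℂ} {I : DyadicCube n} {J : DyadicCube m}
    (hI : whitneyMass lam₁ sn I ≠ ∞)
    (hJ : ∀ q : E m × ℝ, 0 < q.2 → carlesonDensity lam₂ sm q ≠ ∞) :
    carlesonCoeff lam₁ lam₂ (tensorKernel sn sm) I J ≤
      whitneyMass lam₁ sn I * whitneyMass lam₂ sm J := by
  have hpt : ∀ q ∈ J.whitney, ∀ p ∈ I.whitney,
      ∫⁻ y : E n × E m, ‖biTheta (tensorKernel sn sm) p.2 q.2 (fun _ => 1) y‖ₑ ^ 2 *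
        ENNReal.ofReal (gWeight n lam₁ p.2 p.1 y.1 * gWeight m lam₂ q.2 q.1 y.2) ≤
      carlesonDensity lam₁ sn p * carlesonDensity lam₂ sm q := by
    intro q hq p hp
    have hp0 : 0 < p.2 := (half_pos I.side_pos).trans hp.2.1
    have hq0 : 0 < q.2 := (half_pos J.side_pos).trans hq.2.1
    refine (lintegral_prod_le _).trans_eq ?_
    rw [carlesonDensity, ← lintegral_mul_const' _ _ (hJ q hq0)]
    refine lintegral_congr fun y₁ => ?_
    rw [carlesonDensity, ← lintegral_const_mul' _ _ (by finiteness)]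
    refine lintegral_congr fun y₂ => ?_
    rw [biTheta_tensorKernel_one, enorm_mul, ENNReal.ofReal_mul (gWeight_nonneg hp0 _ _)]
    ring
  rw [whitneyMass.eq_def lam₂, ← lintegral_const_mul' _ _ hI]
  refine setLIntegral_mono' J.measurableSet_whitney fun q hq => ?_
  rw [whitneyMass, ← lintegral_mul_const' _ _ (hJ q ((half_pos J.side_pos).trans hq.2.1))]
  exact setLIntegral_mono' I.measurableSet_whitney (hpt q hq)

end BiparameterCarleson

end

theorem mainTheorem2 (n m : ℕ) (hn : 1 ≤ n) (hm : 1 ≤ m) (α β lam₁ lam₂ : ℝ)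
    (hα : 0 < α) (hβ : 0 < β) (hlam₁ : 1 < lam₁) (hlam₂ : 1 < lam₂) (A₁ A₂ B₁ B₂ : ℝ≥0) :
    ∃ C : ℝ≥0,
      ∀ (sn : ℝ → BiparameterCarleson.E n → BiparameterCarleson.E n → ℂ)
        (sm : ℝ → BiparameterCarleson.E m → BiparameterCarleson.E m → ℂ),
        BiparameterCarleson.KernelMeasurable sn → BiparameterCarleson.KernelMeasurable sm →
        BiparameterCarleson.SizeCondition α A₁ sn → BiparameterCarleson.SizeCondition β A₂ sm →
        BiparameterCarleson.GStarL2Bound lam₁ B₁ sn →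
        BiparameterCarleson.GStarL2Bound lam₂ B₂ sm →
        BiparameterCarleson.CarlesonCondition lam₁ lam₂ C
          (BiparameterCarleson.tensorKernel sn sm) := by
  open BiparameterCarleson in
  have hC₁ := carlesonConst_ne_top (A := A₁) (B := B₁) hn hα hlam₁
  have hC₂ := carlesonConst_ne_top (A := A₂) (B := B₂) hm hβ hlam₂
  refine ⟨(carlesonConst n α lam₁ A₁ B₁ * carlesonConst m β lam₂ A₂ B₂).toNNReal, ?_⟩
  intro sn sm hmn hmm hsn hsm hBn hBm Dn Dm hDn hDm Ω hΩ
  rw [ENNReal.coe_toNNReal (ENNReal.mul_ne_top hC₁ hC₂)]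
  have ha := tsum_whitneyMass_le hn hα hlam₁ hmn hsn hBn hDn
  have hb := tsum_whitneyMass_le hm hβ hlam₂ hmm hsm hBm hDm
  refine (ENNReal.tsum_le_tsum fun R => ?_).trans
    (tsum_mul_le_of_carleson hDn hDm ha hb hC₁ (hΩ.measurableSet hDn hDm))
  refine carlesonCoeff_tensorKernel_le ?_ fun q hq =>
    hsm.carlesonDensity_ne_top hm hβ hlam₂ hq
  have hvol : volume R.1.1.toSet ≠ ∞ := by
    rw [DyadicCube.volume_toSet]
    exact ENNReal.ofReal_ne_top
  -- A single coefficient is one term of the Carleson sum over the cube itself, hence finite.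
  refine ne_top_of_le_ne_top (ENNReal.mul_ne_top hC₁ hvol) (le_trans ?_ (ha R.1.1.toSet))
  exact ENNReal.le_tsum (f := fun I : {I // I ∈ Dn ∧ I.toSet ⊆ R.1.1.toSet} =>
    whitneyMass lam₁ sn I) ⟨R.1.1, R.2.1, subset_rfl⟩
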